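/- States are (unnormalized) vectors $|\psi\rangle\in(\mathbb{C}^d)^{\otimes 3}$. The SLOCC class of $|\psi\rangle$ is $\{g_1\otimes g_2\otimes g_3|\psi\rangle : g_i\in GL(d,\mathbb{C})\}$, and its stabilizer is the set of all operators $S=S^{(1)}\otimes S^{(2)}\otimes S^{(3)}$ with $S^{(i)}\in GL(d,\mathbb{C})$ and $S|\psi\rangle=|\psi\rangle$. Two states are LU-equivalent if they agree, up to a nonzero scalar, after applying a local unitary $U_1\otimes U_2\otimes U_3$. In one round of an LOCC protocol, one party performs a measurement with finitely many local operators $A_k$, $\sum_k A_k^\dagger A_k=\mathbb{1}$, broadcasts the outcome $k$, and the other parties apply local unitaries that may depend on $k$; later rounds may depend on all earlier outcomes. A state is transformed into $|\phi\rangle$ by a finite-round protocol if every branch of nonzero probability ends in a state proportional to $|\phi\rangle$, and by a protocol with infinitely many rounds if the fidelity of the output of the first $r$ rounds with $|\phi\rangle$ tends to $1$ as $r\to\infty$. A state is reachable (convertible) under a class of protocols if such a protocol transforms some SLOCC-equivalent, LU-inequivalent state into it (transforms it into some SLOCC-equivalent, LU-inequivalent state). It is weakly isolated if it is neither reachable by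 finite-round LOCC nor convertible by one-round LOCC, and isolated if it is neither reachable nor convertible by LOCC (with finitely or infinitely many rounds). An SLOCC class is isolation-free if it contains no isolated state. Theorem. Let $d\ge 2$ and let $|\Psi_s\rangle\in(\mathbb{C}^d)^{\otimes 3}$ be a 3-qudit state whose stabilizer is exactly $\{S\otimes S\otimes S : S\in SL(d,\mathbb{C})\}$. Then no weakly isolated state exists within the SLOCC class of $|\Psi_s\rangle$. In particular, the SLOCC class of the 3-qutrit totally antisymmetric state $|A_3\rangle=\frac{1}{\sqrt{6}}\sum_{\pi\in S_3}\mathrm{sgn}(\pi)\,|\pi(1),\pi(2),\pi(3)\rangle$ contains no weakly isolated state and is isolation-free. -/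

import Mathlib

open scoped Matrix Topology

noncomputable section

namespace Qudit

/-- Pure (not necessarily normalized) states of `n` qudits of local dimension `d`: the Hilbert space
`(ℂ^d)^{⊗ n}` in the computational basis `|x₁, …, xₙ⟩`, `x : Fin n → Fin d`. -/
abbrev State (n d : ℕ) : Type := EuclideanSpace ℂ (Fin n → Fin d)

/-- The local operator `A₁ ⊗ ⋯ ⊗ Aₙ` as a matrix in the computational basis. -/
def tensorOp {n d : ℕ} (A : Fin n → Matrix (Fin d) (Fin d) ℂ) :
    Matrix (Fin n → Fin d) (Fin n → Fin d) ℂ :=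
  Matrix.of fun x y => ∏ j, A j (x j) (y j)

/-- The state `(A₁ ⊗ ⋯ ⊗ Aₙ)|ψ⟩`. -/
def localApply {n d : ℕ} (A : Fin n → Matrix (Fin d) (Fin d) ℂ) (ψ : State n d) : State n d :=
  Matrix.toEuclideanLin (tensorOp A) ψ

/-- The stabilizer (symmetry group) of `ψ`: the set of the operators `S = S₁ ⊗ ⋯ ⊗ Sₙ` with all
`Sⱼ ∈ GL(d, ℂ)` and `S|ψ⟩ = |ψ⟩`. -/
def stabilizer {n d : ℕ} (ψ : State n d) : Set (Matrix (Fin n → Fin d) (Fin n → Fin d) ℂ) :=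
  {S | ∃ g : Fin n → Matrix.GeneralLinearGroup (Fin d) ℂ,
    S = tensorOp (fun j => (g j : Matrix (Fin d) (Fin d) ℂ)) ∧ Matrix.toEuclideanLin S ψ = ψ}

/-- The SLOCC class of `ψ`: all states `(g₁ ⊗ ⋯ ⊗ gₙ)|ψ⟩` with `gⱼ ∈ GL(d, ℂ)`. -/
def sloccClass {n d : ℕ} (ψ : State n d) : Set (State n d) :=
  {φ | ∃ g : Fin n → Matrix.GeneralLinearGroup (Fin d) ℂ,
    φ = localApply (fun j => (g j : Matrix (Fin d) (Fin d) ℂ)) ψ}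

/-- Equivalence under local unitaries. States are not normalized here, so that it is understood up
to a nonzero scalar. -/
def LUEquiv {n d : ℕ} (ψ φ : State n d) : Prop :=
  ∃ U : Fin n → Matrix.unitaryGroup (Fin d) ℂ, ∃ c : ℂ, c ≠ 0 ∧
    φ = c • localApply (fun j => (U j : Matrix (Fin d) (Fin d) ℂ)) ψ

/-- One round of an LOCC protocol: one party performs a local measurement, given by finitely many
measurement operators `kraus k` that satisfy the completeness relation; the outcome `k` is
broadcast, and every other party `j` applies a unitary `corr k j` that may depend on it. (The value
of `corr k` at the measuring party is not used.) -/
structure Round (n d : ℕ) where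
  party : Fin n
  outcomes : ℕ
  kraus : Fin outcomes → Matrix (Fin d) (Fin d) ℂ
  complete : ∑ k, (kraus k)ᴴ * kraus k = 1
  corr : Fin outcomes → Fin n → Matrix.unitaryGroup (Fin d) ℂ

/-- The state after a round with outcome `k`. It is not renormalized, so that its squared norm,
divided by that of `ψ`, is the probability of the outcome. -/
def Round.apply {n d : ℕ} (R : Round n d) (k : Fin R.outcomes) (ψ : State n d) : State n d :=
  localApply
    (Function.update (fun j => (R.corr k j : Matrix (Fin d) (Fin d) ℂ)) R.party (R.kraus k)) ψ

/-- `LOCCRounds r ψ φ`: there is an LOCC protocol with `r` rounds that transforms `ψ` into `φ` with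
certainty. In each round the measurement and the unitaries may depend on all previous outcomes, and
on each branch the final state is proportional to `φ` (it is zero on branches of probability
zero). -/
def LOCCRounds {n d : ℕ} : ℕ → State n d → State n d → Prop
  | 0, ψ, φ => ∃ c : ℂ, ψ = c • φ
  | r + 1, ψ, φ => ∃ R : Round n d, ∀ k, LOCCRounds r (R.apply k ψ) φ

/-- Transformations by one-round LOCC protocols. -/
def LOCCOne {n d : ℕ} (ψ φ : State n d) : Prop := LOCCRounds 1 ψ φ

/-- Transformations by LOCC protocols with an arbitrary finite number of rounds. -/
def LOCCFin {n d : ℕ} (ψ φ : State n d) : Prop := ∃ r, LOCCRounds r ψ φ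

/-- A protocol with possibly infinitely many rounds: it prescribes the next round for each list of
previous outcomes (the earliest outcome first). -/
abbrev Protocol (n d : ℕ) : Type := List ℕ → Round n d

/-- The overlap of `φ` with the output of the first `r` rounds, `∑ |⟨φ|ψ'⟩|²`, where `ψ'` runs over
the (unnormalized) states of all branches. -/
def Protocol.overlap {n d : ℕ} : Protocol n d → ℕ → State n d → State n d → ℝ
  | _, 0, ψ, φ => ‖inner ℂ φ ψ‖ ^ 2
  | P, r + 1, ψ, φ => ∑ k : Fin (P []).outcomes,
      Protocol.overlap (fun l => P ((k : ℕ) :: l)) r ((P []).apply k ψ) φ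

/-- Transformations by general LOCC protocols, including those with infinitely many rounds: the
fidelity of the target state with the output of the first `r` rounds tends to `1`. -/
def LOCCGen {n d : ℕ} (ψ φ : State n d) : Prop :=
  ∃ P : Protocol n d,
    Filter.Tendsto (fun r => P.overlap r ψ φ) Filter.atTop (𝓝 (‖ψ‖ ^ 2 * ‖φ‖ ^ 2))

/-- `φ` is reachable under the class `T` of transformations: it can be obtained from an
SLOCC-equivalent state that is not LU-equivalent to it. -/
def Reachable {n d : ℕ} (T : State n d → State n d → Prop) (φ : State n d) : Prop :=
  ∃ ψ ∈ sloccClass φ, ¬ LUEquiv ψ φ ∧ T ψ φ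

/-- `ψ` is convertible under the class `T` of transformations: it can be transformed into an
SLOCC-equivalent state that is not LU-equivalent to it. -/
def Convertible {n d : ℕ} (T : State n d → State n d → Prop) (ψ : State n d) : Prop :=
  ∃ φ ∈ sloccClass ψ, ¬ LUEquiv ψ φ ∧ T ψ φ

/-- Weakly isolated: neither reachable by finite-round LOCC nor convertible by one-round LOCC. -/
def WeaklyIsolated {n d : ℕ} (ψ : State n d) : Prop :=
  ¬ Reachable LOCCFin ψ ∧ ¬ Convertible LOCCOne ψ

/-- Isolated: neither reachable nor convertible by LOCC. -/
def Isolated {n d : ℕ} (ψ : State n d) : Prop :=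
  ¬ Reachable LOCCGen ψ ∧ ¬ Convertible LOCCGen ψ

/-- A set of states, such as an SLOCC class, that contains no isolated state. -/
def IsolationFree {n d : ℕ} (C : Set (State n d)) : Prop := ∀ ψ ∈ C, ¬ Isolated ψ

/-- The totally antisymmetric state of `n` qudits of dimension `n`:
`|Aₙ⟩ = (n!)^{-1/2} ∑_π sgn(π) |π(1), …, π(n)⟩`. -/
def antisymState (n : ℕ) : State n n :=
  ((Real.sqrt (n.factorial : ℝ) : ℝ) : ℂ)⁻¹ •
    ∑ π : Equiv.Perm (Fin n),
      ((Equiv.Perm.sign π : ℤ) : ℂ) • EuclideanSpace.single (fun j => π j) (1 : ℂ)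

end Qudit

end

/-!
A state `φ = (g₁ ⊗ g₂ ⊗ g₃)Ψ` is governed, up to local unitaries, by the positive matrices
`Gⱼ = gⱼᴴ gⱼ`, and the symmetries `S ⊗ S ⊗ S` of `Ψ` act on these by simultaneous congruence. A change
of basis makes the factor of one party the identity and that of another one diagonal
(`exists_simultaneous_diagonalization`). Both are then fixed by the diagonal unitaries of determinant
one, among them the sign flips `S = diag(1, …, i, …, -i, …, 1)`, and only the factor `H` of the
remaining party matters.

Whenever `K = H + Sᴴ H S`, one round of LOCC transforms the state with factor `K` into the state with
factor `H` (`HasSLSymmetry.loccOne`): the measurement has two outcomes that lead to `H` and to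
`Sᴴ H S`, and in the second case the other two parties apply unitaries that undo `S`. If `S` changes
`H`, the two states are not LU-equivalent (`HasSLSymmetry.not_luEquiv`): an equivalence would make `K`
a multiple of a unitary conjugate of `H`, so that `H` and `Sᴴ H S`, which have equal Frobenius norm,
would attain equality in the triangle inequality (`conj_eq_self_of_add_conj_eq`).

So there are two cases. If the factor of the remaining party has a nonzero off-diagonal entry, some
sign flip changes it, and the state is reachable. If it is diagonal, it equals `H + Sᴴ H S` for a
positive definite `H` that is not diagonal (`exists_posDef_add_signFlip_conj`), and the state is
convertible. In both cases one round suffices, which settles weak isolation and, because one-round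
protocols are special protocols with infinitely many rounds (`LOCCOne.locc_gen`), also isolation.

The components of `(A₁ ⊗ A₂ ⊗ A₃)|A₃⟩` are determinants of rows of the factors, so that a local symmetry
of `|A₃⟩` preserves the determinant as a trilinear form; this forces its factors to be proportional
(`hasSLSymmetry_antisymState`).
-/

open Matrix
open scoped ComplexOrder

namespace Qudit

variable {n d : ℕ}

/-! ### Tensor products of local operators -/

lemma tensorOp_mul (A B : Fin n → Matrix (Fin d) (Fin d) ℂ) :
    tensorOp A * tensorOp B = tensorOp (fun j => A j * B j) := by
  ext x y
  simp only [tensorOp, mul_apply, of_apply, ← Finset.prod_mul_distrib, Finset.prod_univ_sum,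
    Fintype.piFinset_univ]

lemma tensorOp_one : tensorOp (fun _ : Fin n => (1 : Matrix (Fin d) (Fin d) ℂ)) = 1 := by
  ext x y
  simp only [tensorOp, of_apply, one_apply, Finset.prod_ite_zero, Finset.prod_const_one]
  simp [funext_iff]

lemma tensorOp_conjTranspose (A : Fin n → Matrix (Fin d) (Fin d) ℂ) :
    (tensorOp A)ᴴ = tensorOp (fun j => (A j)ᴴ) := by
  ext x y
  simp [tensorOp, conjTranspose_apply, star_prod]

lemma tensorOp_update_smul (A : Fin n → Matrix (Fin d) (Fin d) ℂ) (p : Fin n)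
    (M : Matrix (Fin d) (Fin d) ℂ) (c : ℂ) :
    tensorOp (Function.update A p (c • M)) = c • tensorOp (Function.update A p M) := by
  ext x y
  simp only [tensorOp, of_apply, Matrix.smul_apply, smul_eq_mul]
  rw [← Finset.mul_prod_erase _ _ (Finset.mem_univ p),
    ← Finset.mul_prod_erase Finset.univ
      (fun j => Function.update A p M j (x j) (y j)) (Finset.mem_univ p)]
  simp only [Function.update_self, Matrix.smul_apply, smul_eq_mul, mul_assoc]
  congr 2
  refine Finset.prod_congr rfl fun j hj => ?_
  simp [Function.update_of_ne (Finset.ne_of_mem_erase hj)]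

lemma tensorOp_update_sum {m : ℕ} (A : Fin n → Matrix (Fin d) (Fin d) ℂ) (p : Fin n)
    (M : Fin m → Matrix (Fin d) (Fin d) ℂ) :
    ∑ k, tensorOp (Function.update A p (M k)) = tensorOp (Function.update A p (∑ k, M k)) := by
  ext x y
  simp only [tensorOp, of_apply, Matrix.sum_apply]
  rw [← Finset.mul_prod_erase _ _ (Finset.mem_univ p)]
  simp only [Function.update_self, Matrix.sum_apply, Finset.sum_mul]
  refine Finset.sum_congr rfl fun k _ => ?_
  rw [← Finset.mul_prod_erase _ _ (Finset.mem_univ p)]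
  simp only [Function.update_self]
  congr 1
  refine Finset.prod_congr rfl fun j hj => ?_
  simp [Function.update_of_ne (Finset.ne_of_mem_erase hj)]

lemma localApply_localApply (A B : Fin n → Matrix (Fin d) (Fin d) ℂ) (ψ : State n d) :
    localApply A (localApply B ψ) = localApply (fun j => A j * B j) ψ := by
  simp [localApply, ← tensorOp_mul, toLpLin_mul_same]

lemma localApply_one (ψ : State n d) :
    localApply (fun _ => (1 : Matrix (Fin d) (Fin d) ℂ)) ψ = ψ := by
  simp [localApply, tensorOp_one]

lemma localApply_smul (A : Fin n → Matrix (Fin d) (Fin d) ℂ) (c : ℂ) (ψ : State n d) :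
    localApply A (c • ψ) = c • localApply A ψ := by
  simp [localApply]

lemma localApply_update_smul (A : Fin n → Matrix (Fin d) (Fin d) ℂ) (p : Fin n)
    (M : Matrix (Fin d) (Fin d) ℂ) (c : ℂ) (ψ : State n d) :
    localApply (Function.update A p (c • M)) ψ = c • localApply (Function.update A p M) ψ := by
  simp [localApply, tensorOp_update_smul]

/-- Equal tensor products of nonzero factors have proportional factors. -/
lemma exists_smul_of_tensorOp_eq {A B : Fin n → Matrix (Fin d) (Fin d) ℂ}
    (hA : ∀ j, A j ≠ 0) (h : tensorOp A = tensorOp B) (i : Fin n) : ∃ c : ℂ, A i = c • B i := by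
  have hne : ∀ j, ∃ x y, A j x y ≠ 0 := fun j => by
    by_contra! hj
    exact hA j (by ext x y; exact hj x y)
  choose x y hxy using hne
  have key : ∀ a b, A i a b * ∏ j ∈ Finset.univ.erase i, A j (x j) (y j) =
      B i a b * ∏ j ∈ Finset.univ.erase i, B j (x j) (y j) := by
    intro a b
    have h1 := congrFun (congrFun h (Function.update x i a)) (Function.update y i b)
    simp only [tensorOp, of_apply] at h1
    rw [← Finset.mul_prod_erase _ _ (Finset.mem_univ i),
      ← Finset.mul_prod_erase Finset.univ (fun j => B j _ _) (Finset.mem_univ i)] at h1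
    simp only [Function.update_self] at h1
    convert h1 using 2 <;>
    · refine Finset.prod_congr rfl fun j hj => ?_
      simp [Function.update_of_ne (Finset.ne_of_mem_erase hj)]
  have hK : ∏ j ∈ Finset.univ.erase i, A j (x j) (y j) ≠ 0 :=
    Finset.prod_ne_zero_iff.2 fun j _ => hxy j
  refine ⟨(∏ j ∈ Finset.univ.erase i, B j (x j) (y j)) /
    ∏ j ∈ Finset.univ.erase i, A j (x j) (y j), ?_⟩
  ext a b
  rw [Matrix.smul_apply, smul_eq_mul, div_mul_eq_mul_div, eq_div_iff hK, key, mul_comm]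

/-! ### Finite and infinite protocols -/

lemma norm_sq_toEuclideanLin (M : Matrix (Fin n → Fin d) (Fin n → Fin d) ℂ) (ψ : State n d) :
    ((‖toEuclideanLin M ψ‖ ^ 2 : ℝ) : ℂ) = inner ℂ ψ (toEuclideanLin (Mᴴ * M) ψ) := by
  rw [toLpLin_mul_same, LinearMap.comp_apply, toEuclideanLin_conjTranspose_eq_adjoint,
    LinearMap.adjoint_inner_right, inner_self_eq_norm_sq_to_K]
  simp

/-- The branch probabilities of a round sum to one. -/
lemma Round.sum_norm_sq_apply (R : Round n d) (ψ : State n d) :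
    ∑ k, ‖R.apply k ψ‖ ^ 2 = ‖ψ‖ ^ 2 := by
  have hk : ∀ k, ((‖R.apply k ψ‖ ^ 2 : ℝ) : ℂ) = inner ℂ ψ (toEuclideanLin (tensorOp
      (Function.update (fun _ => 1) R.party ((R.kraus k)ᴴ * R.kraus k))) ψ) := by
    intro k
    rw [Round.apply, localApply, norm_sq_toEuclideanLin, tensorOp_conjTranspose, tensorOp_mul]
    congr 4
    funext j
    by_cases hj : j = R.party
    · subst hj; simp
    · have := Unitary.coe_star_mul_self (R.corr k j)
      rw [star_eq_conjTranspose] at this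
      simp [Function.update_of_ne hj, this]
  have hsum : ((∑ k, ‖R.apply k ψ‖ ^ 2 : ℝ) : ℂ) = ((‖ψ‖ ^ 2 : ℝ) : ℂ) := by
    rw [Complex.ofReal_sum, Finset.sum_congr rfl fun k _ => hk k, ← inner_sum,
      ← LinearMap.sum_apply, ← map_sum, tensorOp_update_sum, R.complete,
      Function.update_eq_self_iff.2 rfl, tensorOp_one]
    simp [inner_self_eq_norm_sq_to_K]
  exact_mod_cast hsum

/-- The round in which party `p` does nothing. -/
noncomputable def Round.trivial (p : Fin n) : Round n d where
  party := p
  outcomes := 1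
  kraus _ := 1
  complete := by simp
  corr _ _ := 1

lemma Round.trivial_apply (p : Fin n) (k : Fin (Round.trivial (d := d) p).outcomes)
    (ψ : State n d) : (Round.trivial p).apply k ψ = ψ := by
  have : (Function.update (fun j => ((Round.trivial (d := d) p).corr k j :
      Matrix (Fin d) (Fin d) ℂ)) (Round.trivial (d := d) p).party
      ((Round.trivial p).kraus k)) = fun _ => 1 := by
    funext j
    by_cases hj : j = p <;> simp [Round.trivial, Function.update_apply]
  rw [Round.apply, this, localApply_one]

lemma Protocol.overlap_trivial (p : Fin n) (r : ℕ) (ψ φ : State n d) :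
    Protocol.overlap (fun _ => Round.trivial p) r ψ φ = ‖inner ℂ φ ψ‖ ^ 2 := by
  induction r with
  | zero => rfl
  | succ r ih =>
    change ∑ k : Fin 1, Protocol.overlap (fun _ => Round.trivial p) r
      ((Round.trivial p).apply k ψ) φ = _
    rw [Fin.sum_univ_one]
    exact (congrArg (fun χ => Protocol.overlap _ r χ φ)
      (Round.trivial_apply p (0 : Fin 1) ψ)).trans ih

/-- A one-round protocol is a protocol with infinitely many rounds: nothing happens after the first
round. -/
lemma LOCCOne.locc_gen {ψ φ : State n d} (h : LOCCOne ψ φ) : LOCCGen ψ φ := by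
  obtain ⟨R, hR⟩ := h
  choose c hc using hR
  refine ⟨fun l => if l = [] then R else Round.trivial R.party, ?_⟩
  refine tendsto_const_nhds.congr' ?_
  filter_upwards [Filter.eventually_ge_atTop 1] with r hr
  obtain ⟨s, rfl⟩ := Nat.exists_eq_add_of_le' hr
  change _ = ∑ k : Fin R.outcomes, Protocol.overlap (fun _ => Round.trivial R.party) s
    (R.apply k ψ) φ
  simp only [Protocol.overlap_trivial]
  rw [← R.sum_norm_sq_apply ψ, Finset.sum_mul]
  refine Finset.sum_congr rfl fun k _ => ?_
  rw [hc k, inner_smul_right, norm_mul, norm_smul, inner_self_eq_norm_sq_to_K]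
  simp
  ring

lemma LOCCOne.locc_fin {ψ φ : State n d} (h : LOCCOne ψ φ) : LOCCFin ψ φ := ⟨1, h⟩

lemma not_weaklyIsolated {n d : ℕ} {φ : State n d}
    (h : Reachable LOCCOne φ ∨ Convertible LOCCOne φ) : ¬ WeaklyIsolated φ := by
  rintro ⟨h1, h2⟩
  rcases h with ⟨ψ, hψ, hn, h⟩ | h
  · exact h1 ⟨ψ, hψ, hn, h.locc_fin⟩
  · exact h2 h

lemma not_isolated {n d : ℕ} {φ : State n d}
    (h : Reachable LOCCOne φ ∨ Convertible LOCCOne φ) : ¬ Isolated φ := by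
  rintro ⟨h1, h2⟩
  rcases h with ⟨ψ, hψ, hn, h⟩ | ⟨ψ, hψ, hn, h⟩
  · exact h1 ⟨ψ, hψ, hn, h.locc_gen⟩
  · exact h2 ⟨ψ, hψ, hn, h.locc_gen⟩

/-! ### Positive matrices and sign flips -/

/-- The unitary `diag(1, …, i, …, -i, …, 1)` of determinant one, with `i` at `a` and `-i` at `b`.
Conjugation by it fixes diagonal matrices and changes the sign of the `(a, b)` entry. -/
noncomputable def signFlip (a b : Fin d) : Matrix (Fin d) (Fin d) ℂ :=
  diagonal fun x => if x = a then Complex.I else if x = b then -Complex.I else 1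

lemma signFlip_conjTranspose_mul_self (a b : Fin d) : (signFlip a b)ᴴ * signFlip a b = 1 := by
  rw [signFlip, diagonal_conjTranspose, diagonal_mul_diagonal, ← diagonal_one]
  congr 1
  funext x
  by_cases hx : x = a
  · simp [hx]
  · by_cases hx' : x = b
    · subst hx'
      simp [hx]
    · simp [hx, hx']

lemma det_signFlip {a b : Fin d} (hab : a ≠ b) : (signFlip a b).det = 1 := by
  rw [signFlip, det_diagonal, ← Finset.mul_prod_erase _ _ (Finset.mem_univ a),
    ← Finset.mul_prod_erase _ _ (Finset.mem_erase.2 ⟨hab.symm, Finset.mem_univ b⟩)]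
  rw [Finset.prod_eq_one]
  · simp [hab.symm]
  · intro x hx
    simp only [Finset.mem_erase] at hx
    simp [hx.1, hx.2.1]

lemma signFlip_conj_apply (a b : Fin d) (H : Matrix (Fin d) (Fin d) ℂ) (x y : Fin d) :
    ((signFlip a b)ᴴ * H * signFlip a b) x y =
      star (if x = a then Complex.I else if x = b then -Complex.I else 1) * H x y *
        (if y = a then Complex.I else if y = b then -Complex.I else 1) := by
  rw [signFlip, diagonal_conjTranspose, mul_diagonal, diagonal_mul]
  rfl

lemma signFlip_conj_diagonal (a b : Fin d) (D : Fin d → ℂ) :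
    (signFlip a b)ᴴ * diagonal D * signFlip a b = diagonal D := by
  rw [mul_assoc, signFlip, (commute_diagonal D _).eq, ← signFlip, ← mul_assoc,
    signFlip_conjTranspose_mul_self, one_mul]

open scoped MatrixOrder in
lemma exists_conjTranspose_mul_self_eq {M : Matrix (Fin d) (Fin d) ℂ} (hM : M.PosDef) :
    ∃ k : GeneralLinearGroup (Fin d) ℂ,
      (k : Matrix (Fin d) (Fin d) ℂ)ᴴ * (k : Matrix (Fin d) (Fin d) ℂ) = M := by
  obtain ⟨y, rfl⟩ := CStarAlgebra.nonneg_iff_eq_star_mul_self.mp hM.posSemidef.nonneg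
  have hy : IsUnit y := isUnit_of_mul_isUnit_right hM.isUnit
  exact ⟨hy.unit, rfl⟩

lemma posDef_conjTranspose_mul_self (k : GeneralLinearGroup (Fin d) ℂ) :
    ((k : Matrix (Fin d) (Fin d) ℂ)ᴴ * (k : Matrix (Fin d) (Fin d) ℂ)).PosDef :=
  PosDef.conjTranspose_mul_self _ (mulVec_injective_iff_isUnit.2 k.isUnit)

/-- A positive definite matrix `H` and its conjugate under a unitary `S` cannot have a sum that is
proportional to a unitary conjugate of `H`, unless they are equal: by taking traces, the
proportionality factor would be `2`, and this is the equality case of the triangle inequality for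
the Frobenius norm. -/
lemma conj_eq_self_of_add_conj_eq {H S T : Matrix (Fin d) (Fin d) ℂ} (hH : H.IsHermitian)
    (htr : H.trace ≠ 0) (hS : Sᴴ * S = 1) (hT : Tᴴ * T = 1) {μ : ℂ}
    (h : H + Sᴴ * H * S = μ • (Tᴴ * H * T)) : Sᴴ * H * S = H := by
  have hS' : S * Sᴴ = 1 := mul_eq_one_comm.1 hS
  have hT' : T * Tᴴ = 1 := mul_eq_one_comm.1 hT
  have trc : ∀ {V A : Matrix (Fin d) (Fin d) ℂ}, V * Vᴴ = 1 → (Vᴴ * A * V).trace = A.trace := by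
    intro V A hV
    rw [trace_mul_cycle, hV, one_mul]
  have sq : ∀ {V : Matrix (Fin d) (Fin d) ℂ}, V * Vᴴ = 1 →
      ((Vᴴ * H * V) * (Vᴴ * H * V)).trace = (H * H).trace := by
    intro V hV
    rw [← trc (A := H * H) hV]
    congr 1
    calc _ = Vᴴ * H * (V * Vᴴ) * H * V := by simp only [mul_assoc]
      _ = _ := by rw [hV, mul_one]; simp only [mul_assoc]
  have hμ : μ = 2 := by
    have := congrArg trace h
    rw [trace_add, trc hS', trace_smul, trc hT', smul_eq_mul] at this
    have h2 : (μ - 2) * H.trace = 0 := by linear_combination -this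
    rcases mul_eq_zero.1 h2 with h2 | h2
    · linear_combination h2
    · exact absurd h2 htr
  set K := Sᴴ * H * S with hK
  have hKh : Kᴴ = K := (isHermitian_conjTranspose_mul_mul S hH).eq
  have hKK : (K * K).trace = (H * H).trace := sq hS'
  have hsum : ((H + K) * (H + K)).trace = 4 * (H * H).trace := by
    rw [h, hμ, smul_mul_smul_comm, trace_smul, sq hT', smul_eq_mul]
    norm_num
  have hz : ((K - H)ᴴ * (K - H)).trace = 0 := by
    rw [conjTranspose_sub, hKh, hH.eq]
    simp only [add_mul, mul_add, sub_mul, mul_sub, trace_add, trace_sub] at hsum ⊢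
    linear_combination 2 * hKK - hsum
  exact sub_eq_zero.1 (trace_conjTranspose_mul_self_eq_zero_iff.1 hz)

/-- A positive diagonal matrix is the sum of `H` and its sign-flipped copy for a positive definite
`H` with a nonzero `(a, b)` entry: a suitable part of the weight at `a` and `b` is replaced by a
matrix of rank one. -/
lemma exists_posDef_add_signFlip_conj {a b : Fin d} (hab : a ≠ b) {D : Fin d → ℂ}
    (hD : ∀ x, 0 < D x) :
    ∃ H : Matrix (Fin d) (Fin d) ℂ, H.PosDef ∧ H a b ≠ 0 ∧
      H + (signFlip a b)ᴴ * H * signFlip a b = diagonal D := by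
  have hδ : ∃ δ : Fin d → ℝ, (∀ x, 0 < δ x) ∧ ∀ x, D x = δ x := by
    refine ⟨fun x => (D x).re, fun x => (Complex.pos_iff.1 (hD x)).1, fun x => ?_⟩
    exact Complex.ext rfl (by simpa using (Complex.pos_iff.1 (hD x)).2.symm)
  obtain ⟨δ, hpos, hDδ⟩ := hδ
  let v : Fin d → ℂ := fun x => if x = a ∨ x = b then ((Real.sqrt (δ x) / 2 : ℝ) : ℂ) else 0
  let e : Fin d → ℂ := fun x => if x = a ∨ x = b then ((δ x / 4 : ℝ) : ℂ) else ((δ x / 2 : ℝ) : ℂ)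
  have hv : ∀ x, x = a ∨ x = b → v x * star (v x) = ((δ x / 4 : ℝ) : ℂ) := by
    intro x hx
    simp only [v, if_pos hx, Complex.star_def, Complex.conj_ofReal]
    rw [← Complex.ofReal_mul]
    congr 1
    have := Real.mul_self_sqrt (hpos x).le
    linear_combination this / 4
  refine ⟨diagonal e + vecMulVec v (star v), ?_, ?_, ?_⟩
  · refine PosDef.add_posSemidef (PosDef.diagonal fun x => ?_) (posSemidef_vecMulVec_self_star v)
    have := hpos x
    simp only [e]
    split_ifs <;> rw [Complex.zero_lt_real] <;> positivity
  · have h1 := (Real.sqrt_pos.2 (hpos a)).ne'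
    have h2 := (Real.sqrt_pos.2 (hpos b)).ne'
    simp [diagonal_apply_ne _ hab, vecMulVec_apply, v, h1, h2]
  · ext x y
    rw [Matrix.add_apply, signFlip_conj_apply, Matrix.add_apply, vecMulVec_apply]
    by_cases hxy : x = y
    · subst hxy
      by_cases hx : x = a ∨ x = b
      · have h1 := hv x hx
        simp only [Pi.star_apply, diagonal_apply_eq, h1, e, if_pos hx, hDδ]
        rcases hx with rfl | rfl
        · simp
          ring_nf
          simp
          ring
        · simp [hab.symm]
          ring_nf
          simp
          ring
      · push Not at hx
        simp [hx.1, hx.2, e, v, hDδ]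
    · rw [diagonal_apply_ne _ hxy, diagonal_apply_ne _ hxy]
      by_cases hx : x = a ∨ x = b
      · by_cases hy : y = a ∨ y = b
        · rcases hx with rfl | rfl <;> rcases hy with rfl | rfl
          · exact absurd rfl hxy
          · simp [hab.symm]
            ring_nf
            simp
          · simp [hab.symm]
            ring_nf
            simp
          · exact absurd rfl hxy
        · simp [v, hy]
      · simp [v, hx]

/-! ### States with the symmetries `S ⊗ S ⊗ S` -/

/-- The local symmetries of `Ψ` are the operators `S ⊗ S ⊗ S` with `det S = 1`. The second field
records only that the factors of a symmetry are proportional to one matrix: the factors of a tensor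
product are determined only up to scalars, and the product of the scalars plays no role. -/
structure HasSLSymmetry (Ψ : State 3 d) : Prop where
  localApply_eq : ∀ S : Matrix (Fin d) (Fin d) ℂ, S.det = 1 → localApply (fun _ => S) Ψ = Ψ
  exists_smul : ∀ g : Fin 3 → Matrix (Fin d) (Fin d) ℂ, (∀ j, IsUnit (g j)) →
    localApply g Ψ = Ψ → ∃ (T : Matrix (Fin d) (Fin d) ℂ) (γ : Fin 3 → ℂ), ∀ j, g j = γ j • T

lemma HasSLSymmetry.of_stabilizer_eq [Nonempty (Fin d)] {Ψ : State 3 d}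
    (h : stabilizer Ψ = {T | ∃ S : SpecialLinearGroup (Fin d) ℂ,
      T = tensorOp (fun _ : Fin 3 => (S : Matrix (Fin d) (Fin d) ℂ))}) : HasSLSymmetry Ψ where
  localApply_eq S hS := by
    have : tensorOp (fun _ : Fin 3 => S) ∈ stabilizer Ψ := h ▸ ⟨⟨S, hS⟩, rfl⟩
    obtain ⟨-, -, hg⟩ := this
    exact hg
  exists_smul g hg hΨ := by
    have : tensorOp g ∈ stabilizer Ψ := ⟨fun j => (hg j).unit, rfl, hΨ⟩
    rw [h] at this
    obtain ⟨S, hS⟩ := this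
    choose γ hγ using exists_smul_of_tensorOp_eq (fun j => (hg j).ne_zero) hS
    exact ⟨_, γ, hγ⟩

/-- The symmetry property is stable under a simultaneous change of basis of the three factors. -/
lemma HasSLSymmetry.basis_change {Ψ : State 3 d} (h : HasSLSymmetry Ψ)
    (P : GeneralLinearGroup (Fin d) ℂ) :
    HasSLSymmetry (localApply (fun _ => ((P⁻¹ : GeneralLinearGroup (Fin d) ℂ) :
      Matrix (Fin d) (Fin d) ℂ)) Ψ) where
  localApply_eq S hS := by
    have hdet : ((P : Matrix (Fin d) (Fin d) ℂ) * S *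
        ((P⁻¹ : GeneralLinearGroup (Fin d) ℂ) : Matrix (Fin d) (Fin d) ℂ)).det = 1 := by
      rw [det_mul_right_comm, Units.mul_inv, one_mul, hS]
    conv_rhs => rw [← h.localApply_eq _ hdet]
    simp only [localApply_localApply, mul_assoc, Units.inv_mul_cancel_left]
  exists_smul g hg hΨ := by
    rw [localApply_localApply] at hΨ
    have h1 := congrArg (localApply (fun _ => (P : Matrix (Fin d) (Fin d) ℂ))) hΨ
    rw [localApply_localApply, localApply_localApply] at h1
    simp only [Units.mul_inv, localApply_one] at h1
    obtain ⟨T, γ, hT⟩ := h.exists_smul _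
      (fun j => P.isUnit.mul ((hg j).mul (P⁻¹).isUnit)) h1
    refine ⟨((P⁻¹ : GeneralLinearGroup (Fin d) ℂ) : Matrix (Fin d) (Fin d) ℂ) * T * P, γ,
      fun j => ?_⟩
    rw [← smul_mul_assoc, ← mul_smul_comm, ← hT j]
    simp [mul_assoc]

lemma localApply_mem_sloccClass {n : ℕ} (Ψ : State n d)
    (g h : Fin n → GeneralLinearGroup (Fin d) ℂ) :
    localApply (fun j => (h j : Matrix (Fin d) (Fin d) ℂ)) Ψ ∈
      sloccClass (localApply (fun j => (g j : Matrix (Fin d) (Fin d) ℂ)) Ψ) := by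
  refine ⟨fun j => h j * (g j)⁻¹, ?_⟩
  rw [localApply_localApply]
  simp only [Units.val_mul, mul_assoc, Units.inv_mul, mul_one]

/-! ### The transformation step -/

lemma mul_mul_inv_mem_unitaryGroup {S : Matrix (Fin d) (Fin d) ℂ}
    (h : GeneralLinearGroup (Fin d) ℂ)
    (hS : Sᴴ * ((h : Matrix (Fin d) (Fin d) ℂ)ᴴ * (h : Matrix (Fin d) (Fin d) ℂ)) * S =
      (h : Matrix (Fin d) (Fin d) ℂ)ᴴ * (h : Matrix (Fin d) (Fin d) ℂ)) :
    (h : Matrix (Fin d) (Fin d) ℂ) * S *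
      ((h⁻¹ : GeneralLinearGroup (Fin d) ℂ) : Matrix (Fin d) (Fin d) ℂ) ∈
        unitaryGroup (Fin d) ℂ := by
  rw [mem_unitaryGroup_iff', star_eq_conjTranspose]
  set X := (h : Matrix (Fin d) (Fin d) ℂ) with hX
  set Y := ((h⁻¹ : GeneralLinearGroup (Fin d) ℂ) : Matrix (Fin d) (Fin d) ℂ) with hY
  have hXY : X * Y = 1 := h.mul_inv
  calc (X * S * Y)ᴴ * (X * S * Y) = Yᴴ * (Sᴴ * (Xᴴ * X) * S) * Y := by
        simp only [conjTranspose_mul, mul_assoc]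
    _ = (X * Y)ᴴ * (X * Y) := by rw [hS]; simp only [conjTranspose_mul, mul_assoc]
    _ = 1 := by simp [hXY]

/-- If `Gⱼ = (h j)ᴴ (h j)` is invariant under congruence by `S` at the parties `1` and `2`, and
`kᴴ k = mᴴ m + Sᴴ mᴴ m S`, then party `0` can turn the factor `k` into `m`: its measurement operators
`m k⁻¹` and `m S k⁻¹` lead to the target up to the symmetry `S ⊗ S ⊗ S`, and the other parties undo
`S` by unitaries. No factor `1/√2` occurs in these operators, as `kᴴ k` is the sum and not the mean
of the two terms. -/
lemma HasSLSymmetry.loccOne {Ψ : State 3 d} (hΨ : HasSLSymmetry Ψ)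
    {h : Fin 3 → GeneralLinearGroup (Fin d) ℂ} {S : Matrix (Fin d) (Fin d) ℂ} (hdet : S.det = 1)
    (hS : ∀ j ≠ 0, Sᴴ * ((h j : Matrix (Fin d) (Fin d) ℂ)ᴴ * (h j : Matrix (Fin d) (Fin d) ℂ)) * S =
      (h j : Matrix (Fin d) (Fin d) ℂ)ᴴ * (h j : Matrix (Fin d) (Fin d) ℂ))
    {k m : GeneralLinearGroup (Fin d) ℂ}
    (hk : (m : Matrix (Fin d) (Fin d) ℂ)ᴴ * (m : Matrix (Fin d) (Fin d) ℂ) +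
      Sᴴ * ((m : Matrix (Fin d) (Fin d) ℂ)ᴴ * (m : Matrix (Fin d) (Fin d) ℂ)) * S =
      (k : Matrix (Fin d) (Fin d) ℂ)ᴴ * (k : Matrix (Fin d) (Fin d) ℂ)) :
    LOCCOne (localApply (fun j => (Function.update h 0 k j : Matrix (Fin d) (Fin d) ℂ)) Ψ)
      (localApply (fun j => (Function.update h 0 m j : Matrix (Fin d) (Fin d) ℂ)) Ψ) := by
  let X : Matrix (Fin d) (Fin d) ℂ := m
  let Y : Matrix (Fin d) (Fin d) ℂ := k
  let Z : Matrix (Fin d) (Fin d) ℂ := (k⁻¹ : GeneralLinearGroup (Fin d) ℂ)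
  have hYZ : Y * Z = 1 := k.mul_inv
  have hZY : Z * Y = 1 := k.inv_mul
  let R : Round 3 d :=
    { party := 0
      outcomes := 2
      kraus := ![X * Z, X * S * Z]
      complete := by
        rw [Fin.sum_univ_two]
        calc (X * Z)ᴴ * (X * Z) + (X * S * Z)ᴴ * (X * S * Z)
            = Zᴴ * (Xᴴ * X + Sᴴ * (Xᴴ * X) * S) * Z := by
              simp only [conjTranspose_mul, mul_assoc, mul_add, add_mul]
          _ = (Y * Z)ᴴ * (Y * Z) := by rw [hk]; simp only [conjTranspose_mul, mul_assoc, Y]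
          _ = 1 := by simp [hYZ]
      corr := ![fun _ => 1, ![1, ⟨_, mul_mul_inv_mem_unitaryGroup (h 1) (hS 1 (by decide))⟩,
        ⟨_, mul_mul_inv_mem_unitaryGroup (h 2) (hS 2 (by decide))⟩]] }
  refine ⟨R, fun o => ⟨1, ?_⟩⟩
  rw [one_smul, Round.apply, localApply_localApply]
  change Fin 2 at o
  fin_cases o
  · congr 1
    funext j
    fin_cases j
    · change Function.update (_ : Fin 3 → Matrix (Fin d) (Fin d) ℂ) 0 (X * Z) 0 *
        (Function.update h 0 k 0 : Matrix (Fin d) (Fin d) ℂ) =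
          (Function.update h 0 m 0 : Matrix (Fin d) (Fin d) ℂ)
      rw [Function.update_self, Function.update_self, Function.update_self, mul_assoc, hZY,
        mul_one]
    · simp [R]
    · simp [R]
  · conv_rhs => rw [← hΨ.localApply_eq S hdet, localApply_localApply]
    congr 1
    funext j
    fin_cases j
    · change Function.update (_ : Fin 3 → Matrix (Fin d) (Fin d) ℂ) 0 (X * S * Z) 0 *
        (Function.update h 0 k 0 : Matrix (Fin d) (Fin d) ℂ) =
          (Function.update h 0 m 0 : Matrix (Fin d) (Fin d) ℂ) * S
      rw [Function.update_self, Function.update_self, Function.update_self, mul_assoc, hZY,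
        mul_one]
    · simp [R, mul_assoc]
    · simp [R, mul_assoc]

lemma conjTranspose_mul_self_of_unitary_mul_eq (U : unitaryGroup (Fin d) ℂ)
    {k h T : Matrix (Fin d) (Fin d) ℂ} {γ : ℂ}
    (e : (U : Matrix (Fin d) (Fin d) ℂ) * k = γ • (h * T)) :
    kᴴ * k = (star γ * γ) • (Tᴴ * (hᴴ * h) * T) := by
  have hU : (U : Matrix (Fin d) (Fin d) ℂ)ᴴ * (U : Matrix (Fin d) (Fin d) ℂ) = 1 :=
    Unitary.coe_star_mul_self U
  calc kᴴ * k = ((U : Matrix (Fin d) (Fin d) ℂ) * k)ᴴ * ((U : Matrix (Fin d) (Fin d) ℂ) * k) := by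
        rw [conjTranspose_mul, mul_assoc, ← mul_assoc _ _ k, hU, one_mul]
    _ = _ := by
        rw [e, conjTranspose_smul, smul_mul_smul_comm]
        simp only [conjTranspose_mul, mul_assoc]

/-- The states with the factors `k` and `m` at party `0` are not LU-equivalent: by the form of the symmetries, such an equivalence would
make `kᴴ k` proportional to a conjugate of `mᴴ m` under a matrix that is unitary, as it fixes
`(h 1)ᴴ (h 1) = 1`. -/
lemma HasSLSymmetry.not_luEquiv {Ψ : State 3 d} (hΨ : HasSLSymmetry Ψ)
    {h : Fin 3 → GeneralLinearGroup (Fin d) ℂ}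
    (h1 : (h 1 : Matrix (Fin d) (Fin d) ℂ)ᴴ * (h 1 : Matrix (Fin d) (Fin d) ℂ) = 1) {a b : Fin d}
    {k m : GeneralLinearGroup (Fin d) ℂ}
    (hk : (m : Matrix (Fin d) (Fin d) ℂ)ᴴ * (m : Matrix (Fin d) (Fin d) ℂ) +
      (signFlip a b)ᴴ * ((m : Matrix (Fin d) (Fin d) ℂ)ᴴ * (m : Matrix (Fin d) (Fin d) ℂ)) *
        signFlip a b =
      (k : Matrix (Fin d) (Fin d) ℂ)ᴴ * (k : Matrix (Fin d) (Fin d) ℂ))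
    (hab : a ≠ b) (hm : ((m : Matrix (Fin d) (Fin d) ℂ)ᴴ * (m : Matrix (Fin d) (Fin d) ℂ)) a b ≠ 0) :
    ¬ LUEquiv (localApply (fun j => (Function.update h 0 k j : Matrix (Fin d) (Fin d) ℂ)) Ψ)
      (localApply (fun j => (Function.update h 0 m j : Matrix (Fin d) (Fin d) ℂ)) Ψ) := by
  rintro ⟨U, c, hc, e⟩
  have : Nonempty (Fin d) := ⟨a⟩
  let h' := Function.update h 0 m
  let k' := Function.update h 0 k
  let g : Fin 3 → Matrix (Fin d) (Fin d) ℂ := fun j =>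
    ((h' j)⁻¹ : GeneralLinearGroup (Fin d) ℂ) * (U j * k' j)
  have hgu : ∀ j, IsUnit (g j) := fun j =>
    ((h' j)⁻¹).isUnit.mul ((Unitary.toUnits (U j)).isUnit.mul (k' j).isUnit)
  have hg : localApply (Function.update g 0 (c • g 0)) Ψ = Ψ := by
    rw [localApply_update_smul, Function.update_eq_self]
    have e' := congrArg (localApply fun j =>
      (((h' j)⁻¹ : GeneralLinearGroup (Fin d) ℂ) : Matrix (Fin d) (Fin d) ℂ)) e
    rw [localApply_smul, localApply_localApply, localApply_localApply, localApply_localApply] at e'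
    have hinv : ∀ j, (((h' j)⁻¹ : GeneralLinearGroup (Fin d) ℂ) : Matrix (Fin d) (Fin d) ℂ) *
        (Function.update h 0 m j : Matrix (Fin d) (Fin d) ℂ) = 1 := fun j => (h' j).inv_mul
    simp only [hinv, localApply_one, mul_assoc] at e'
    exact e'.symm
  obtain ⟨T, γ, hT⟩ := hΨ.exists_smul _ (fun j => by
    by_cases hj : j = 0
    · subst hj
      rw [Function.update_self]
      exact (hgu 0).smul (Units.mk0 c hc)
    · rw [Function.update_of_ne hj]
      exact hgu j) hg
  have hUk : ∀ j, (U j : Matrix (Fin d) (Fin d) ℂ) * k' j = h' j * g j := fun j => by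
    simp [g]
  have e1 := conjTranspose_mul_self_of_unitary_mul_eq (γ := 1) (T := γ 1 • T) (U 1)
    (h := h 1) (k := h 1) (by
      have := hUk 1
      rw [← Function.update_of_ne (show (1 : Fin 3) ≠ 0 by decide) (c • g 0) g, hT 1] at this
      simpa [h', k'] using this)
  rw [h1, star_one, one_mul, one_smul, mul_one] at e1
  have hγ : γ 1 ≠ 0 := by
    intro h0
    rw [h0, zero_smul, mul_zero] at e1
    exact one_ne_zero e1
  have e0 := conjTranspose_mul_self_of_unitary_mul_eq (γ := c⁻¹ * γ 0 * (γ 1)⁻¹) (T := γ 1 • T)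
    (U 0) (h := m) (k := k) (by
      have := hUk 0
      have hT0 := hT 0
      rw [Function.update_self] at hT0
      have hg0 : g 0 = (c⁻¹ * γ 0) • T := by
        rw [mul_smul, ← hT0, inv_smul_smul₀ hc]
      rw [hg0] at this
      rw [mul_smul_comm, smul_smul, mul_assoc, inv_mul_cancel₀ hγ, mul_one, ← mul_smul_comm]
      simpa [h', k'] using this)
  have hpos := posDef_conjTranspose_mul_self m
  have hinv := conj_eq_self_of_add_conj_eq hpos.isHermitian hpos.trace_pos.ne'
    (signFlip_conjTranspose_mul_self a b) e1.symm (hk.trans e0)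
  have hent := congrFun (congrFun hinv a) b
  rw [signFlip_conj_apply, if_pos rfl, if_neg hab.symm, if_pos rfl, Complex.star_def,
    Complex.conj_I] at hent
  -- the sign flip changes the sign of the entry at `(a, b)`
  refine hm (self_eq_neg.1 ?_)
  linear_combination -hent +
    (((m : Matrix (Fin d) (Fin d) ℂ)ᴴ * (m : Matrix (Fin d) (Fin d) ℂ)) a b) * Complex.I_mul_I

/-- The factors at the parties `1` and `2` can be brought to the form `(h 1)ᴴ (h 1) = 1` and
`(h 2)ᴴ (h 2)` diagonal, by a simultaneous change of basis of the three factors. -/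
lemma exists_simultaneous_diagonalization (g : Fin 3 → GeneralLinearGroup (Fin d) ℂ) :
    ∃ (P : GeneralLinearGroup (Fin d) ℂ) (D : Fin d → ℂ),
      ((g 1 * P : GeneralLinearGroup (Fin d) ℂ) : Matrix (Fin d) (Fin d) ℂ)ᴴ *
        ((g 1 * P : GeneralLinearGroup (Fin d) ℂ) : Matrix (Fin d) (Fin d) ℂ) = 1 ∧
      ((g 2 * P : GeneralLinearGroup (Fin d) ℂ) : Matrix (Fin d) (Fin d) ℂ)ᴴ *
        ((g 2 * P : GeneralLinearGroup (Fin d) ℂ) : Matrix (Fin d) (Fin d) ℂ) = diagonal D := by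
  have hM := (posDef_conjTranspose_mul_self (g 2 * (g 1)⁻¹)).isHermitian
  let W := hM.eigenvectorUnitary
  have hspec := hM.conjStarAlgAut_star_eigenvectorUnitary
  rw [Unitary.conjStarAlgAut_star_apply] at hspec
  have hW : (W : Matrix (Fin d) (Fin d) ℂ)ᴴ * (W : Matrix (Fin d) (Fin d) ℂ) = 1 :=
    Unitary.coe_star_mul_self W
  refine ⟨(g 1)⁻¹ * Unitary.toUnits W, _, ?_, Eq.trans ?_ hspec⟩
  · rw [mul_inv_cancel_left]
    exact hW
  · rw [← mul_assoc, Units.val_mul, conjTranspose_mul]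
    simp only [mul_assoc]
    rfl

/-- After the simultaneous change of basis, a state whose factor at party `0` is not diagonal is
reachable, and a state whose factor there is diagonal is convertible. -/
theorem HasSLSymmetry.reachable_or_convertible (hd : 2 ≤ d) {Ψ : State 3 d} (hΨ : HasSLSymmetry Ψ)
    {φ : State 3 d} (hφ : φ ∈ sloccClass Ψ) : Reachable LOCCOne φ ∨ Convertible LOCCOne φ := by
  obtain ⟨g, rfl⟩ := hφ
  obtain ⟨P, D, h1, h2⟩ := exists_simultaneous_diagonalization g
  let h : Fin 3 → GeneralLinearGroup (Fin d) ℂ := fun j => g j * P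
  have hφ : localApply (fun j => (g j : Matrix (Fin d) (Fin d) ℂ)) Ψ =
      localApply (fun j => (h j : Matrix (Fin d) (Fin d) ℂ)) (localApply (fun _ =>
        ((P⁻¹ : GeneralLinearGroup (Fin d) ℂ) : Matrix (Fin d) (Fin d) ℂ)) Ψ) := by
    rw [localApply_localApply]
    simp [h, mul_assoc]
  rw [hφ]
  have hΨ' := hΨ.basis_change P
  generalize localApply (fun _ => ((P⁻¹ : GeneralLinearGroup (Fin d) ℂ) :
    Matrix (Fin d) (Fin d) ℂ)) Ψ = Φ at hΨ'
  have hS : ∀ (a b : Fin d), ∀ j ≠ 0, (signFlip a b)ᴴ *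
      ((h j : Matrix (Fin d) (Fin d) ℂ)ᴴ * (h j : Matrix (Fin d) (Fin d) ℂ)) * signFlip a b =
      (h j : Matrix (Fin d) (Fin d) ℂ)ᴴ * (h j : Matrix (Fin d) (Fin d) ℂ) := by
    intro a b j hj
    fin_cases j
    · exact absurd rfl hj
    · change _ * ((h 1 : Matrix (Fin d) (Fin d) ℂ)ᴴ * (h 1 : Matrix (Fin d) (Fin d) ℂ)) * _ =
        (h 1 : Matrix (Fin d) (Fin d) ℂ)ᴴ * (h 1 : Matrix (Fin d) (Fin d) ℂ)
      rw [h1, mul_one, signFlip_conjTranspose_mul_self]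
    · change _ * ((h 2 : Matrix (Fin d) (Fin d) ℂ)ᴴ * (h 2 : Matrix (Fin d) (Fin d) ℂ)) * _ =
        (h 2 : Matrix (Fin d) (Fin d) ℂ)ᴴ * (h 2 : Matrix (Fin d) (Fin d) ℂ)
      rw [h2, signFlip_conj_diagonal]
  have h0 := posDef_conjTranspose_mul_self (h 0)
  by_cases hdiag : ∃ a b, a ≠ b ∧
      ((h 0 : Matrix (Fin d) (Fin d) ℂ)ᴴ * (h 0 : Matrix (Fin d) (Fin d) ℂ)) a b ≠ 0
  · left
    -- the source has the factor `G + Sᴴ G S` at party `0`, where `G` is the factor of the target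
    obtain ⟨a, b, hab, hne⟩ := hdiag
    obtain ⟨k, hk⟩ := exists_conjTranspose_mul_self_eq (h0.add_posSemidef
      (h0.posSemidef.conjTranspose_mul_mul_same (signFlip a b)))
    refine ⟨_, localApply_mem_sloccClass Φ h (Function.update h 0 k), ?_⟩
    have hl := hΨ'.not_luEquiv (h := h) h1 (m := h 0) hk.symm hab hne
    have ht := hΨ'.loccOne (h := h) (det_signFlip hab) (hS a b) (m := h 0) hk.symm
    rw [Function.update_eq_self] at hl ht
    exact ⟨hl, ht⟩
  · right
    push Not at hdiag
    -- the target has the factor `H` at party `0`, where `H + Sᴴ H S` is the factor of the source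
    have hab : (⟨0, by omega⟩ : Fin d) ≠ ⟨1, by omega⟩ := by simp
    generalize (⟨0, _⟩ : Fin d) = a at hab
    generalize (⟨1, _⟩ : Fin d) = b at hab
    obtain ⟨H, hH, hne, hsum⟩ := exists_posDef_add_signFlip_conj hab
      (D := fun x => ((h 0 : Matrix (Fin d) (Fin d) ℂ)ᴴ * (h 0 : Matrix (Fin d) (Fin d) ℂ)) x x)
      fun x => h0.diag_pos
    obtain ⟨m, rfl⟩ := exists_conjTranspose_mul_self_eq hH
    have hk := hsum.trans (show _ = (h 0 : Matrix (Fin d) (Fin d) ℂ)ᴴ *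
        (h 0 : Matrix (Fin d) (Fin d) ℂ) by
      ext x y
      by_cases hxy : x = y
      · rw [hxy, diagonal_apply_eq]
      · rw [diagonal_apply_ne _ hxy, hdiag x y hxy])
    refine ⟨_, localApply_mem_sloccClass Φ h (Function.update h 0 m), ?_⟩
    have hl := hΨ'.not_luEquiv (h := h) h1 (k := h 0) hk hab hne
    have ht := hΨ'.loccOne (h := h) (det_signFlip hab) (hS a b) (k := h 0) hk
    rw [Function.update_eq_self] at hl ht
    exact ⟨hl, ht⟩

/-! ### The antisymmetric state -/

/-- The components of `(A₁ ⊗ ⋯ ⊗ Aₙ)|Aₙ⟩` are determinants of rows of the factors. -/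
lemma localApply_antisymState_apply {n : ℕ} (A : Fin n → Matrix (Fin n) (Fin n) ℂ)
    (x : Fin n → Fin n) :
    localApply A (antisymState n) x =
      ((Real.sqrt (n.factorial : ℝ) : ℝ) : ℂ)⁻¹ * (of fun j => A j (x j)).det := by
  have hsingle : ∀ y, localApply A (EuclideanSpace.single y (1 : ℂ)) x = ∏ j, A j (x j) (y j) := by
    intro y
    simp [localApply, tensorOp, toLpLin_apply]
  rw [← det_transpose, det_apply']
  simp only [transpose_apply, of_apply, ← hsingle]
  simp [localApply, antisymState, Finset.sum_apply]

lemma sqrt_factorial_inv_ne_zero (n : ℕ) :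
    (((Real.sqrt (n.factorial : ℝ) : ℝ) : ℂ)⁻¹) ≠ 0 := by
  have : (0 : ℝ) < n.factorial := by exact_mod_cast n.factorial_pos
  exact inv_ne_zero (Complex.ofReal_ne_zero.2 (Real.sqrt_pos.2 this).ne')

lemma localApply_antisymState_of_det_eq_one {n : ℕ} {S : Matrix (Fin n) (Fin n) ℂ}
    (hS : S.det = 1) : localApply (fun _ => S) (antisymState n) = antisymState n := by
  ext x
  conv_rhs => rw [← localApply_one (antisymState n)]
  rw [localApply_antisymState_apply, localApply_antisymState_apply]
  have : (of fun j => S (x j)) = (of fun j => (1 : Matrix (Fin n) (Fin n) ℂ) (x j)) * S := by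
    ext i j
    simp [mul_apply, one_apply]
  rw [this, det_mul, hS, mul_one]

/-- A local symmetry of the antisymmetric state preserves the determinant as a multilinear form in
the rows. -/
lemma det_vecMul_of_localApply_antisymState {n : ℕ} {g : Fin n → Matrix (Fin n) (Fin n) ℂ}
    (hg : localApply g (antisymState n) = antisymState n) (u : Fin n → Fin n → ℂ) :
    (of fun j => u j ᵥ* g j).det = (of u).det := by
  cases n with
  | zero => simp
  | succ n =>
    have h := congrArg (fun ψ => localApply (fun j => of fun _ => u j) ψ (fun _ => 0)) hg
    simp only [localApply_localApply, localApply_antisymState_apply] at h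
    have h' := mul_left_cancel₀ (sqrt_factorial_inv_ne_zero _) h
    exact h'

/-- The hypothesis says that every vector `u` is a left eigenvector of `M`, so that `M` is scalar. -/
lemma eq_smul_one_of_det_eq_zero {M : Matrix (Fin 3) (Fin 3) ℂ}
    (h : ∀ u w : Fin 3 → ℂ, (of ![u, u ᵥ* M, w]).det = 0) : M = M 0 0 • 1 := by
  have e : ∀ u w : Fin 3 → ℂ, _ := fun u w => (det_fin_three _).symm.trans (h u w)
  have a1 := e ![1, 0, 0] ![0, 1, 0]
  have a2 := e ![1, 0, 0] ![0, 0, 1]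
  have a3 := e ![0, 1, 0] ![1, 0, 0]
  have a4 := e ![0, 1, 0] ![0, 0, 1]
  have a5 := e ![0, 0, 1] ![1, 0, 0]
  have a6 := e ![0, 0, 1] ![0, 1, 0]
  have a7 := e ![1, 1, 0] ![0, 0, 1]
  have a8 := e ![1, 0, 1] ![0, 1, 0]
  simp [vecMul, dotProduct, Fin.sum_univ_three] at a1 a2 a3 a4 a5 a6 a7 a8
  ext i j
  fin_cases i <;> fin_cases j <;> simp <;> grind

lemma hasSLSymmetry_antisymState : HasSLSymmetry (antisymState 3) where
  localApply_eq _ hS := localApply_antisymState_of_det_eq_one hS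
  exists_smul g hg hΨ := by
    have hdet := det_vecMul_of_localApply_antisymState hΨ
    obtain ⟨a, ha⟩ := hg 0
    obtain ⟨b, hb⟩ := hg 1
    obtain ⟨c, hc⟩ := hg 2
    let A : Matrix (Fin 3) (Fin 3) ℂ := (a⁻¹ : GeneralLinearGroup (Fin 3) ℂ)
    let B : Matrix (Fin 3) (Fin 3) ℂ := (b⁻¹ : GeneralLinearGroup (Fin 3) ℂ)
    let C : Matrix (Fin 3) (Fin 3) ℂ := (c⁻¹ : GeneralLinearGroup (Fin 3) ℂ)
    have hA : A * g 0 = 1 := ha ▸ a.inv_mul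
    have hB : B * g 1 = 1 := hb ▸ b.inv_mul
    have hC : C * g 2 = 1 := hc ▸ c.inv_mul
    have hA' : g 0 * A = 1 := mul_eq_one_comm.1 hA
    have h1 := eq_smul_one_of_det_eq_zero (M := A * g 1) fun u w => by
      have h := (hdet ![u ᵥ* A, u ᵥ* A, w ᵥ* C]).trans
        (det_zero_of_row_eq (i := 0) (j := 1) (by decide) rfl)
      rw [← h]
      congr 1
      ext i j
      fin_cases i <;> simp [vecMul_vecMul, hA, hC]
    have h2 := eq_smul_one_of_det_eq_zero (M := A * g 2) fun u w => by
      have h := (hdet ![u ᵥ* A, w ᵥ* B, u ᵥ* A]).trans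
        (det_zero_of_row_eq (i := 0) (j := 2) (by decide) rfl)
      have hrow : (of fun j => ![u ᵥ* A, w ᵥ* B, u ᵥ* A] j ᵥ* g j) =
          of ![u, w, u ᵥ* (A * g 2)] := by
        ext i j
        fin_cases i <;> simp [vecMul_vecMul, hA, hB]
      rw [hrow, det_fin_three] at h
      rw [det_fin_three]
      simp only [of_apply, cons_val] at h ⊢
      linear_combination -h
    refine ⟨g 0, ![1, (A * g 1) 0 0, (A * g 2) 0 0], fun j => ?_⟩
    fin_cases j
    · simp
    · calc g 1 = g 0 * (A * g 1) := by rw [← mul_assoc, hA', one_mul]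
        _ = _ := by rw [h1]; simp
    · calc g 2 = g 0 * (A * g 2) := by rw [← mul_assoc, hA', one_mul]
        _ = _ := by rw [h2]; simp

end Qudit

theorem theorem3 :
    (∀ d : ℕ, 2 ≤ d → ∀ Ψ : Qudit.State 3 d,
      Qudit.stabilizer Ψ =
        {T | ∃ S : Matrix.SpecialLinearGroup (Fin d) ℂ,
          T = Qudit.tensorOp (fun _ : Fin 3 => (S : Matrix (Fin d) (Fin d) ℂ))} →
      ∀ φ ∈ Qudit.sloccClass Ψ, ¬ Qudit.WeaklyIsolated φ) ∧
    (∀ φ ∈ Qudit.sloccClass (Qudit.antisymState 3), ¬ Qudit.WeaklyIsolated φ) ∧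
    Qudit.IsolationFree (Qudit.sloccClass (Qudit.antisymState 3)) := by
  refine ⟨fun d hd Ψ hΨ φ hφ => ?_, fun φ hφ => ?_, fun φ hφ => ?_⟩
  · have : Nonempty (Fin d) := ⟨⟨0, by omega⟩⟩
    exact Qudit.not_weaklyIsolated
      ((Qudit.HasSLSymmetry.of_stabilizer_eq hΨ).reachable_or_convertible hd hφ)
  · exact Qudit.not_weaklyIsolated
      (Qudit.hasSLSymmetry_antisymState.reachable_or_convertible (by norm_num) hφ)
  · exact Qudit.not_isolated
      (Qudit.hasSLSymmetry_antisymState.reachable_or_convertible (by norm_num) hφ)
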